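/- Let $K$ be a field, $S=K[x_1,\dots,x_n]$, and order monomials lexicographically with $x_1>_{lex}\cdots>_{lex}x_n$. Let $I\subset S$ be an initial lexsegment edge ideal, i.e. there is a squarefree monomial $v$ of degree $2$ such that $I$ is generated by all squarefree monomials $w$ of degree $2$ with $w\geq_{lex}v$. Let $t\geq 1$ and let $G(I^t)=\{u_1,\dots,u_m\}$, with $u_1>_{lex}\cdots>_{lex}u_m$, be the set of minimal monomial generators of $I^t$. For a monomial $w\ne 1$ let $\max(w)$ be the largest $k$ with $x_k\mid w$; let $\mathrm{set}(u_i)=\{x_r : x_r\in(u_1,\dots,u_{i-1}):(u_i)\}$; and let $\beta_p(J)=\dim_K \mathrm{Tor}^S_p(K,J)$ denote the Betti numbers of a graded ideal $J$, where $K=S/(x_1,\dots,x_n)$. Then the following hold. 1. For all $1\le i\le m$ the ideal $(u_1,\dots,u_{i-1}):(u_i)$ is generated by the variables in $\mathrm{set}(u_i)$ (so $I^t$ has linear quotients), and $$|\mathrm{set}(u_i)|=\begin{cases}\max(u_i)-2, & \text{if } x_j^t\mid u_i \text{ for some } j<\max(u_i),\\ \max(u_i)-1, & \text{otherwise.}\end{cases}$$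 2. If $t=1$, so that $u_1,\dots,u_m$ are the minimal generators of $I$, then for all $p\ge 0$ $$\beta_p(I)=\sum_{i=1}^m\binom{\max(u_i)-2}{p}.$$ 3. For every $t\geq 1$ (in particular for $t>1$) and all $p\ge 0$ $$\beta_p(I^t)=\sum_{i\notin A}\binom{\max(u_i)-1}{p}+\sum_{i\in A}\binom{\max(u_i)-2}{p},$$ where $A=\{i : x_j^t\mid u_i\text{ for some } j<\max(u_i)\}$. -/

import Mathlib

open MvPolynomial CategoryTheory

universe u

/-- Exponent vectors `w` of squarefree monomials of degree `2`. The variables `x₁, …, xₙ` are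
indexed by `Fin n`, `x_k` being `X ⟨k - 1, _⟩`. -/
def IsSqfreeQuadric {n : ℕ} (w : Fin n →₀ ℕ) : Prop :=
  w.degree = 2 ∧ ∀ k, w k ≤ 1

/-- The initial lexsegment set `L^i(v)`: squarefree monomials `w` of degree `2` with
`w ≥_lex v`, where `x₁ >_lex ⋯ >_lex xₙ`. -/
def initialLexsegment {n : ℕ} (v : Fin n →₀ ℕ) : Set (Fin n →₀ ℕ) :=
  {w | IsSqfreeQuadric w ∧ toLex v ≤ toLex w}

/-- Initial lexsegment edge ideals of `K[x₁, …, xₙ]`. -/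
def IsInitialLexsegmentEdgeIdeal {n : ℕ} {K : Type u} [Field K]
    (I : Ideal (MvPolynomial (Fin n) K)) : Prop :=
  ∃ v : Fin n →₀ ℕ, IsSqfreeQuadric v ∧
    I = Ideal.span ((fun w => monomial w (1 : K)) '' initialLexsegment v)

/-- `G(J)`: (exponents of) the minimal monomial generators of a monomial ideal `J`, i.e. the
monomials of `J` that are minimal with respect to divisibility. -/
def minMonomialGens {n : ℕ} {K : Type u} [Field K]
    (J : Ideal (MvPolynomial (Fin n) K)) : Set (Fin n →₀ ℕ) :=
  {w | Minimal (fun a : Fin n →₀ ℕ => monomial a (1 : K) ∈ J) w}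

/-- `max(w)`: the largest index (counted from `1`) of a variable dividing the monomial `w`. -/
def maxVar {n : ℕ} (w : Fin n →₀ ℕ) : ℕ :=
  w.support.sup fun k => (k : ℕ) + 1

/-- The colon ideal `(u₁, …, u_{i-1}) : (u_i)`. -/
noncomputable def quotientIdeal {n m : ℕ} (K : Type u) [Field K] (u : Fin m → (Fin n →₀ ℕ))
    (i : Fin m) : Ideal (MvPolynomial (Fin n) K) :=
  (Ideal.span ((fun j => monomial (u j) (1 : K)) '' Set.Iio i)).colon
    {monomial (u i) (1 : K)}

/-- `set(u_i)`: the (indices of) variables lying in `(u₁, …, u_{i-1}) : (u_i)`. -/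
def linearSet {n m : ℕ} (K : Type u) [Field K] (u : Fin m → (Fin n →₀ ℕ)) (i : Fin m) :
    Set (Fin n) :=
  {r | (X r : MvPolynomial (Fin n) K) ∈ quotientIdeal K u i}

/-- The Betti number `β_p(J) = dim_K Tor_p^S(S/(x₁, …, xₙ), J)` for `S = K[x₁, …, xₙ]`; the
dimension is taken as a cardinal, so that no junk value occurs. -/
noncomputable def betti {n : ℕ} {K : Type u} [Field K] (p : ℕ)
    (J : Ideal (MvPolynomial (Fin n) K)) : Cardinal.{u} :=
  Module.rank K ((ModuleCat.restrictScalars (algebraMap K (MvPolynomial (Fin n) K))).obj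
    (((Tor (ModuleCat.{u} (MvPolynomial (Fin n) K)) p).obj
      (ModuleCat.of _ (MvPolynomial (Fin n) K ⧸
        Ideal.span (Set.range (X : Fin n → MvPolynomial (Fin n) K))))).obj
      (ModuleCat.of _ J)))

/-! ### Products of `t` edges and the exchange property. -/

section LexsegmentCombinatorics

variable {n : ℕ}

/-! The generators of `I ^ t` are the products of `t` edges; all have degree `2t` and no exponent
above `t`. Being an initial segment gives an exchange property (`lexsegmentProducts_exchange`): if
`M` is the last variable of a product `w`, then `w * x_r / x_M` is again a product for each `r < M`
whose exponent in `w` is below `t`. So `set(u_i)` consists exactly of the variables before the last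
one with exponent below `t` (`mem_linearSet_iff`). They generate the colon ideal, because the first
variable in which an earlier `u_j` differs from `u_i` is one of them
(`quotientIdeal_eq_span_linearSet`). By degree, at most one variable before the last has exponent
`t`, which gives the two values of `|set(u_i)|`.

For the Betti numbers, adjoining `u_i` amounts to a mapping cone with the Koszul resolution of its
colon ideal (`HasLinearResolution.sup_span_singleton`), so `u_i` contributes `|set(u_i)|` choose `p`
to the `p`-th rank. All generators have the same degree, so the differentials stay linear; they
vanish after tensoring with `S/(x₁, …, xₙ)`, and the ranks are the dimensions of Tor
(`HasLinearResolution.betti_eq`). -/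

theorem exists_eq_single_of_degree_eq_one {c : Fin n →₀ ℕ} (hc : c.degree = 1) :
    ∃ s, c = Finsupp.single s 1 := by
  obtain ⟨s, hs⟩ : ∃ s, c s ≠ 0 := by
    by_contra! hcon
    obtain rfl : c = 0 := Finsupp.ext hcon
    simp at hc
  obtain ⟨e, rfl⟩ := exists_add_of_le
    (Finsupp.single_le_iff.2 (Nat.one_le_iff_ne_zero.2 hs) : Finsupp.single s 1 ≤ c)
  rw [map_add, Finsupp.degree_single] at hc
  obtain rfl := (Finsupp.degree_eq_zero_iff e).1 (by omega)
  exact ⟨s, add_zero _⟩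

theorem isSqfreeQuadric_single_add_single {p q : Fin n} (h : p ≠ q) :
    IsSqfreeQuadric (Finsupp.single p 1 + Finsupp.single q 1) := by
  refine ⟨by simp, fun k => ?_⟩
  simp only [Finsupp.add_apply, Finsupp.single_apply]
  split_ifs with h1 h2
  · exact absurd (h1.trans h2.symm) h
  all_goals simp

theorem IsSqfreeQuadric.exists_eq_single_add_single {w : Fin n →₀ ℕ} (h : IsSqfreeQuadric w) :
    ∃ p q, p ≠ q ∧ w = Finsupp.single p 1 + Finsupp.single q 1 := by
  have hone : ∀ k ∈ w.support, w k = 1 := fun k hk =>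
    le_antisymm (h.2 k) (Nat.one_le_iff_ne_zero.2 (Finsupp.mem_support_iff.1 hk))
  have hcard : w.support.card = 2 := by
    rw [← h.1, Finsupp.degree_apply, Finset.sum_congr rfl hone, Finset.sum_const, smul_eq_mul,
      mul_one]
  obtain ⟨p, q, hpq, hs⟩ := Finset.card_eq_two.1 hcard
  refine ⟨p, q, hpq, ?_⟩
  ext k
  by_cases hk : k ∈ w.support
  · rw [hone k hk]
    rw [hs, Finset.mem_insert, Finset.mem_singleton] at hk
    rcases hk with rfl | rfl
    · simp [hpq]
    · simp [hpq]
  · rw [Finsupp.notMem_support_iff.1 hk]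
    rw [hs, Finset.mem_insert, Finset.mem_singleton, not_or] at hk
    simp [hk.1, hk.2]

theorem IsSqfreeQuadric.exists_eq_add_single {w : Fin n →₀ ℕ} (h : IsSqfreeQuadric w) {M : Fin n}
    (hM : w M ≠ 0) : ∃ p, p ≠ M ∧ w = Finsupp.single p 1 + Finsupp.single M 1 := by
  obtain ⟨p, q, hpq, rfl⟩ := h.exists_eq_single_add_single
  by_cases hp : p = M
  · subst hp
    exact ⟨q, hpq.symm, add_comm _ _⟩
  · by_cases hq : q = M
    · subst hq
      exact ⟨p, hp, rfl⟩
    · simp [Ne.symm hp, Ne.symm hq] at hM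

/-- Lowering the index of a variable raises a monomial in the lex order, so an initial segment is
closed under it as long as squarefreeness survives. -/
theorem single_add_single_mem_initialLexsegment {v : Fin n →₀ ℕ} {p r M : Fin n}
    (h : Finsupp.single p 1 + Finsupp.single M 1 ∈ initialLexsegment v) (hpr : p ≠ r)
    (hr : r < M) : Finsupp.single p 1 + Finsupp.single r 1 ∈ initialLexsegment v := by
  refine ⟨isSqfreeQuadric_single_add_single hpr, h.2.trans ?_⟩
  rw [toLex_add, toLex_add]
  exact add_le_add_right (Finsupp.Lex.single_le_iff.2 hr.le) _

/-- Exponents of products of `t` monomials of `L^i(v)`. -/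
def lexsegmentProducts (v : Fin n →₀ ℕ) (t : ℕ) : Set (Fin n →₀ ℕ) :=
  {w | ∃ s : Multiset (Fin n →₀ ℕ), s.card = t ∧ (∀ e ∈ s, e ∈ initialLexsegment v) ∧ s.sum = w}

theorem degree_of_mem_lexsegmentProducts {v w : Fin n →₀ ℕ} {t : ℕ}
    (h : w ∈ lexsegmentProducts v t) : w.degree = 2 * t := by
  obtain ⟨s, rfl, hs, rfl⟩ := h
  rw [map_multiset_sum, Multiset.map_congr rfl fun e he => (hs e he).1.1]
  simp [mul_comm]

theorem apply_le_of_mem_lexsegmentProducts {v w : Fin n →₀ ℕ} {t : ℕ}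
    (h : w ∈ lexsegmentProducts v t) (r : Fin n) : w r ≤ t := by
  obtain ⟨s, rfl, hs, rfl⟩ := h
  rw [← Finsupp.applyAddHom_apply, map_multiset_sum]
  refine (Multiset.sum_le_card_nsmul _ 1 fun x hx => ?_).trans (by simp)
  obtain ⟨e, he, rfl⟩ := Multiset.mem_map.1 hx
  exact (hs e he).1.2 r

/-- Replacing the last variable of a product of `t` edges by an earlier variable whose exponent is
less than `t` gives again a product of `t` edges. -/
theorem lexsegmentProducts_exchange {v y : Fin n →₀ ℕ} {t : ℕ} {M r : Fin n}
    (h : y + Finsupp.single M 1 ∈ lexsegmentProducts v t) (hy : ∀ k, M < k → y k = 0)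
    (hr : r < M) (hyr : y r < t) : y + Finsupp.single r 1 ∈ lexsegmentProducts v t := by
  obtain ⟨s, rfl, hs, hsum⟩ := h
  have hMs : ∃ e ∈ s, e M ≠ 0 := by
    by_contra! hcon
    have h0 : s.sum M = 0 := by
      rw [← Finsupp.applyAddHom_apply, map_multiset_sum]
      refine Multiset.sum_eq_zero fun x hx => ?_
      obtain ⟨e, he, rfl⟩ := Multiset.mem_map.1 hx
      exact hcon e he
    rw [hsum] at h0
    simp at h0
  obtain ⟨e, he, heM⟩ := hMs
  obtain ⟨p, hpM, rfl⟩ := (hs e he).1.exists_eq_add_single heM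
  obtain ⟨s, rfl⟩ := Multiset.exists_cons_of_mem he
  rw [Multiset.forall_mem_cons] at hs
  rw [Multiset.sum_cons, add_right_comm] at hsum
  obtain rfl := add_right_cancel hsum
  -- Trading `x_M` for `x_r` inside the edge `x_p x_M` works unless `p = r`, where it would produce
  -- a square and a second edge is needed.
  by_cases hpr : p = r
  · subst hpr
    -- If all remaining `t - 1` edges contained `x_p`, then `y p` would be at least `t`.
    have hex : ∃ e ∈ s, e p = 0 := by
      by_contra! hcon
      have hle : s.card ≤ s.sum p := by
        rw [← Finsupp.applyAddHom_apply p s.sum, map_multiset_sum]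
        have := Multiset.card_nsmul_le_sum (s := s.map (Finsupp.applyAddHom p)) (a := 1)
          fun x hx => by
            obtain ⟨e, he, rfl⟩ := Multiset.mem_map.1 hx
            exact Nat.one_le_iff_ne_zero.2 (hcon e he)
        simpa using this
      rw [Finsupp.add_apply, Finsupp.single_eq_same, Multiset.card_cons] at hyr
      omega
    obtain ⟨f, hf, hfp⟩ := hex
    obtain ⟨s, rfl⟩ := Multiset.exists_cons_of_mem hf
    rw [Multiset.forall_mem_cons] at hs
    -- If `f = x_a x_b` avoids `x_M`, then `a, b < M` and the pair is replaced by `(x_p x_a)(x_p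
    -- x_b)`. If `f = x_a x_M`, the edge `x_p x_M` is kept and `f` becomes `x_a x_p`.
    by_cases hfM : f M = 0
    · obtain ⟨a, b, hab, rfl⟩ := hs.2.1.1.exists_eq_single_add_single
      have hlt : ∀ c, (Finsupp.single a 1 + Finsupp.single b 1 : Fin n →₀ ℕ) c ≠ 0 →
          p ≠ c ∧ c < M := fun c hc => by
        refine ⟨by rintro rfl; exact hc hfp, lt_of_le_of_ne (not_lt.1 fun hMc => ?_)
          (by rintro rfl; exact hc hfM)⟩
        have := hy c hMc
        rw [Multiset.sum_cons, Finsupp.add_apply, Finsupp.add_apply] at this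
        omega
      obtain ⟨hpa, haM⟩ := hlt a (by simp)
      obtain ⟨hpb, hbM⟩ := hlt b (by simp)
      refine ⟨(Finsupp.single p 1 + Finsupp.single a 1) ::ₘ
        (Finsupp.single p 1 + Finsupp.single b 1) ::ₘ s, by simp, ?_, ?_⟩
      · simp only [Multiset.forall_mem_cons]
        exact ⟨single_add_single_mem_initialLexsegment hs.1 hpa haM,
          single_add_single_mem_initialLexsegment hs.1 hpb hbM, hs.2.2⟩
      · simp only [Multiset.sum_cons]
        abel
    · obtain ⟨a, -, rfl⟩ := hs.2.1.1.exists_eq_add_single hfM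
      have hap : a ≠ p := by
        rintro rfl
        simp at hfp
      refine ⟨(Finsupp.single p 1 + Finsupp.single M 1) ::ₘ
        (Finsupp.single a 1 + Finsupp.single p 1) ::ₘ s, by simp, ?_, ?_⟩
      · simp only [Multiset.forall_mem_cons]
        exact ⟨hs.1, single_add_single_mem_initialLexsegment hs.2.1 hap hr, hs.2.2⟩
      · simp only [Multiset.sum_cons]
        abel
  · refine ⟨(Finsupp.single p 1 + Finsupp.single r 1) ::ₘ s, by simp, ?_, ?_⟩
    · rw [Multiset.forall_mem_cons]
      exact ⟨single_add_single_mem_initialLexsegment hs.1 hpr hr, hs.2⟩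
    · rw [Multiset.sum_cons]
      abel

theorem lexsegmentProducts_succ (v : Fin n →₀ ℕ) (t : ℕ) :
    lexsegmentProducts v (t + 1) =
      {w | ∃ a ∈ lexsegmentProducts v t, ∃ e ∈ initialLexsegment v, a + e = w} := by
  ext w
  constructor
  · rintro ⟨s, hc, hs, rfl⟩
    obtain ⟨e, he⟩ := Multiset.card_pos_iff_exists_mem.1 (by omega : 0 < s.card)
    obtain ⟨s, rfl⟩ := Multiset.exists_cons_of_mem he
    rw [Multiset.forall_mem_cons] at hs
    exact ⟨s.sum, ⟨s, by simpa using hc, hs.2, rfl⟩, e, hs.1, by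
      rw [Multiset.sum_cons, add_comm]⟩
  · rintro ⟨_, ⟨s, rfl, hs, rfl⟩, e, he, rfl⟩
    exact ⟨e ::ₘ s, by simp, by simpa only [Multiset.forall_mem_cons] using ⟨he, hs⟩, by
      rw [Multiset.sum_cons, add_comm]⟩

theorem span_initialLexsegment_pow (K : Type u) [Field K] (v : Fin n →₀ ℕ) (t : ℕ) :
    (Ideal.span ((fun w => monomial w (1 : K)) '' initialLexsegment v)) ^ t =
      Ideal.span ((fun w => monomial w (1 : K)) '' lexsegmentProducts v t) := by
  induction t with
  | zero =>
    have h0 : lexsegmentProducts v 0 = {0} := by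
      ext w
      constructor
      · rintro ⟨s, hs, -, rfl⟩
        rw [Multiset.card_eq_zero.1 hs]
        rfl
      · rintro rfl
        exact ⟨0, rfl, by simp, rfl⟩
    rw [h0, pow_zero, Set.image_singleton]
    exact Ideal.one_eq_top.trans Ideal.span_singleton_one.symm
  | succ t ih =>
    rw [pow_succ, ih, Ideal.span_mul_span', lexsegmentProducts_succ]
    congr 1
    ext f
    constructor
    · rintro ⟨_, ⟨a, ha, rfl⟩, _, ⟨e, he, rfl⟩, rfl⟩
      exact ⟨a + e, ⟨a, ha, e, he, rfl⟩, by simp [monomial_mul]⟩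
    · rintro ⟨_, ⟨a, ha, e, he, rfl⟩, rfl⟩
      exact ⟨_, ⟨a, ha, rfl⟩, _, ⟨e, he, rfl⟩, by simp [monomial_mul]⟩

/-- Monomials of equal degree never divide each other properly, so no generator is redundant. -/
theorem minMonomialGens_span_of_degree_eq {K : Type u} [Field K] {T : Set (Fin n →₀ ℕ)} {d : ℕ}
    (hT : ∀ w ∈ T, w.degree = d) :
    minMonomialGens (Ideal.span ((fun w => monomial w (1 : K)) '' T)) = T := by
  have hmem : ∀ a : Fin n →₀ ℕ,
      monomial a (1 : K) ∈ Ideal.span ((fun w => monomial w (1 : K)) '' T) ↔ ∃ w ∈ T, w ≤ a := by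
    intro a
    rw [mem_ideal_span_monomial_image]
    simp
  have heq : ∀ {a w : Fin n →₀ ℕ}, a ≤ w → w.degree ≤ a.degree → w ≤ a := fun {a w} h hd => by
    obtain ⟨c, rfl⟩ := exists_add_of_le h
    rw [map_add] at hd
    obtain rfl := (Finsupp.degree_eq_zero_iff c).1 (by omega)
    simp
  ext w
  constructor
  · rintro ⟨h1, h2⟩
    obtain ⟨a, ha, haw⟩ := (hmem w).1 h1
    rwa [le_antisymm (h2 ((hmem a).2 ⟨a, ha, le_rfl⟩) haw) haw]
  · intro hw
    refine ⟨(hmem w).2 ⟨w, hw, le_rfl⟩, fun a ha haw => heq haw ?_⟩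
    obtain ⟨b, hb, hba⟩ := (hmem a).1 ha
    rw [hT w hw, ← hT b hb]
    exact Finsupp.degree_mono hba

/-- Membership in a monomial ideal is tested on the support, and multiplying by `u i` translates the
support. -/
theorem mem_quotientIdeal_iff {K : Type u} [Field K] {m : ℕ} (u : Fin m → (Fin n →₀ ℕ))
    (i : Fin m) (f : MvPolynomial (Fin n) K) :
    f ∈ quotientIdeal K u i ↔ ∀ a ∈ f.support, ∃ j < i, u j ≤ a + u i := by
  rw [quotientIdeal, Submodule.mem_colon_singleton, smul_eq_mul,
    ← Set.image_image (fun w => monomial w (1 : K)) u, mem_ideal_span_monomial_image]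
  simp only [Set.exists_mem_image, Set.mem_Iio]
  constructor
  · intro h a ha
    refine h (a + u i) ?_
    rw [mem_support_iff, coeff_mul_monomial, mul_one]
    exact mem_support_iff.1 ha
  · intro h a ha
    rw [mem_support_iff, coeff_mul_monomial'] at ha
    split_ifs at ha with hle
    · rw [mul_one] at ha
      obtain ⟨j, hj, hja⟩ := h _ (mem_support_iff.2 ha)
      rw [tsub_add_cancel_of_le hle] at hja
      exact ⟨j, hj, hja⟩
    · exact absurd rfl ha

theorem lt_maxVar_iff {w : Fin n →₀ ℕ} {r : Fin n} :
    (r : ℕ) + 1 < maxVar w ↔ ∃ s, r < s ∧ w s ≠ 0 := by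
  rw [maxVar, Finset.lt_sup_iff]
  simp only [Finsupp.mem_support_iff, add_lt_add_iff_right, Fin.val_fin_lt]
  exact exists_congr fun _ => and_comm

theorem maxVar_le (w : Fin n →₀ ℕ) : maxVar w ≤ n :=
  Finset.sup_le fun k _ => k.2

theorem exists_maxVar_eq {w : Fin n →₀ ℕ} (hw : 0 < maxVar w) :
    ∃ M : Fin n, w M ≠ 0 ∧ maxVar w = M + 1 ∧ ∀ k, M < k → w k = 0 := by
  have hne : w.support.Nonempty := by
    rw [Finset.nonempty_iff_ne_empty]
    intro h
    rw [maxVar, h] at hw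
    exact lt_irrefl _ hw
  obtain ⟨M, hM, hsup⟩ := Finset.exists_mem_eq_sup _ hne fun k : Fin n => (k : ℕ) + 1
  refine ⟨M, Finsupp.mem_support_iff.1 hM, hsup, fun k hk => ?_⟩
  by_contra hwk
  have h := lt_maxVar_iff.2 ⟨k, hk, hwk⟩
  rw [show maxVar w = (M : ℕ) + 1 from hsup] at h
  exact lt_irrefl _ h

/-! ### Linear quotients and the size of `set(u_i)`. -/

section LinearQuotients

variable {K : Type u} [Field K] {m t : ℕ} {u : Fin m → (Fin n →₀ ℕ)}

/-- If `u_j` divides `x_r u_i`, equality of degrees forces `x_r u_i = x_s u_j`. Then `u_j >_lex u_i`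
gives `r < s`, so `x_s` divides `u_i`, and `u_j r ≤ t` bounds the exponent of `x_r` in `u_i`. The
converse is the exchange property. -/
theorem mem_linearSet_iff (hlex : StrictAnti fun i => toLex (u i)) {v : Fin n →₀ ℕ}
    (hu : Set.range u = lexsegmentProducts v t) (i : Fin m) (r : Fin n) :
    r ∈ linearSet K u i ↔ (r : ℕ) + 1 < maxVar (u i) ∧ u i r < t := by
  have huT : ∀ j, u j ∈ lexsegmentProducts v t := fun j => hu ▸ Set.mem_range_self j
  rw [linearSet, Set.mem_ofPred_eq, mem_quotientIdeal_iff, support_X]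
  simp only [Finset.mem_singleton, forall_eq]
  constructor
  · rintro ⟨j, hji, hle⟩
    obtain ⟨c, hc⟩ := exists_add_of_le hle
    have hcd : c.degree = 1 := by
      have := congrArg Finsupp.degree hc
      simp only [map_add, Finsupp.degree_single, degree_of_mem_lexsegmentProducts (huT _)] at this
      omega
    obtain ⟨s, rfl⟩ := exists_eq_single_of_degree_eq_one hcd
    have hlt : toLex (u i) < toLex (u j) := hlex hji
    have hrs : r < s := by
      rw [← Finsupp.Lex.single_lt_iff]
      have h1 : toLex (Finsupp.single r 1) + toLex (u i) =
          toLex (u j) + toLex (Finsupp.single s 1) := hc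
      by_contra hcon
      have h2 := add_lt_add_of_le_of_lt (not_lt.1 hcon) hlt
      rw [h1, add_comm] at h2
      exact lt_irrefl _ h2
    have hs := DFunLike.congr_fun hc s
    have hr := DFunLike.congr_fun hc r
    simp only [Finsupp.add_apply, Finsupp.single_eq_same, Finsupp.single_eq_of_ne hrs.ne',
      Finsupp.single_eq_of_ne hrs.ne] at hs hr
    have := apply_le_of_mem_lexsegmentProducts (huT j) r
    exact ⟨lt_maxVar_iff.2 ⟨s, hrs, by omega⟩, by omega⟩
  · rintro ⟨hrM, hrt⟩
    obtain ⟨M, hM, hMeq, hMk⟩ := exists_maxVar_eq (w := u i) (by omega)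
    have hrM : r < M := by
      rw [hMeq] at hrM
      exact Fin.lt_def.2 (by omega)
    have hle : Finsupp.single M 1 ≤ u i := by
      rw [Finsupp.single_le_iff]
      omega
    obtain ⟨y, hy⟩ := exists_add_of_le hle
    rw [add_comm] at hy
    have hyr : ∀ k, k ≠ M → y k = u i k := fun k hk => by
      rw [hy, Finsupp.add_apply, Finsupp.single_eq_of_ne hk, add_zero]
    have hmem := lexsegmentProducts_exchange (hy ▸ huT i)
      (fun k hk => (hyr k hk.ne').trans (hMk k hk)) hrM ((hyr r hrM.ne).trans_lt hrt)
    rw [← hu] at hmem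
    obtain ⟨j, hj⟩ := hmem
    refine ⟨j, ?_, ?_⟩
    · rw [← hlex.lt_iff_gt]
      simp only [hj]
      rw [hy, toLex_add, toLex_add]
      exact add_lt_add_right (Finsupp.Lex.single_lt_iff.2 hrM) _
    · rw [hj, hy, add_comm]
      exact add_le_add_right le_self_add _

theorem quotientIdeal_eq_span_linearSet (hlex : StrictAnti fun i => toLex (u i))
    {v : Fin n →₀ ℕ} (hu : Set.range u = lexsegmentProducts v t) (i : Fin m) :
    quotientIdeal K u i = Ideal.span (X '' linearSet K u i) := by
  have huT : ∀ j, u j ∈ lexsegmentProducts v t := fun j => hu ▸ Set.mem_range_self j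
  apply le_antisymm
  · intro f hf
    rw [mem_quotientIdeal_iff] at hf
    rw [mem_ideal_span_X_image]
    intro a ha
    obtain ⟨j, hji, hle⟩ := hf a ha
    -- The required variable is the first one where `u_i` and `u_j` differ. Were it no earlier than
    -- the last variable of `u_i`, then `u_i` would divide `u_j`, against equality of degrees.
    obtain ⟨r, hlow, hr⟩ := Finsupp.Lex.lt_iff.1 (hlex hji)
    have hr' : u i r < u j r := hr
    have hlow' : ∀ k < r, u i k = u j k := hlow
    have hler := hle r
    rw [Finsupp.add_apply] at hler
    refine ⟨r, (mem_linearSet_iff hlex hu i r).2 ⟨lt_maxVar_iff.2 ?_, ?_⟩, by omega⟩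
    · by_contra! hcon
      have hle' : u i ≤ u j := fun k => by
        rcases lt_trichotomy k r with hk | rfl | hk
        · exact (hlow' k hk).le
        · exact hr'.le
        · rw [hcon k hk]
          exact Nat.zero_le _
      obtain ⟨c, hc⟩ := exists_add_of_le hle'
      have hd := congrArg Finsupp.degree hc
      rw [map_add, degree_of_mem_lexsegmentProducts (huT i),
        degree_of_mem_lexsegmentProducts (huT j)] at hd
      obtain rfl := (Finsupp.degree_eq_zero_iff c).1 (by omega)
      rw [hc, add_zero] at hr'
      exact lt_irrefl _ hr'
    · exact hr'.trans_le (apply_le_of_mem_lexsegmentProducts (huT j) r)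
  · rw [Ideal.span_le]
    rintro _ ⟨r, hr, rfl⟩
    exact hr

theorem ncard_linearSet (hlex : StrictAnti fun i => toLex (u i)) {v : Fin n →₀ ℕ}
    (hu : Set.range u = lexsegmentProducts v t) (i : Fin m)
    [Decidable (∃ j : Fin n, (j : ℕ) + 1 < maxVar (u i) ∧ t ≤ u i j)] :
    (linearSet K u i).ncard =
      if ∃ j : Fin n, (j : ℕ) + 1 < maxVar (u i) ∧ t ≤ u i j
      then maxVar (u i) - 2 else maxVar (u i) - 1 := by
  classical
  have huT : u i ∈ lexsegmentProducts v t := hu ▸ Set.mem_range_self i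
  have hB : (Finset.univ.filter fun r : Fin n => (r : ℕ) + 1 < maxVar (u i)).card =
      maxVar (u i) - 1 := by
    have hle := maxVar_le (u i)
    rw [Finset.filter_congr (q := fun r : Fin n => (r : ℕ) < maxVar (u i) - 1)
      fun r _ => by omega, Fin.card_filter_val_lt]
    omega
  have hset : linearSet K u i = ((Finset.univ.filter fun r : Fin n =>
      (r : ℕ) + 1 < maxVar (u i)) \ (Finset.univ.filter fun r : Fin n =>
      (r : ℕ) + 1 < maxVar (u i) ∧ t ≤ u i r) : Finset (Fin n)) := by
    ext r
    rw [mem_linearSet_iff hlex hu]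
    simp
    tauto
  rw [hset, Set.ncard_coe_finset, Finset.card_sdiff_of_subset, hB]
  · split_ifs with h
    · obtain ⟨j, hj, htj⟩ := h
      have hone : (Finset.univ.filter fun r : Fin n =>
          (r : ℕ) + 1 < maxVar (u i) ∧ t ≤ u i r) = {j} := by
        ext k
        simp only [Finset.mem_filter, Finset.mem_univ, true_and, Finset.mem_singleton]
        refine ⟨fun ⟨hk, htk⟩ => ?_, by rintro rfl; exact ⟨hj, htj⟩⟩
        by_contra hkj
        obtain ⟨M, hM, hMeq, -⟩ := exists_maxVar_eq (w := u i) (by omega)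
        have hjM : j ≠ M := by rintro rfl; omega
        have hkM : k ≠ M := by rintro rfl; omega
        -- Two exponents at least `t` together with the positive exponent of `x_M` would exceed the
        -- degree `2t`.
        have hsum : ∑ x ∈ {k, j, M}, u i x ≤ (u i).degree := by
          rw [Finsupp.degree_eq_sum]
          exact Finset.sum_le_sum_of_subset (Finset.subset_univ _)
        rw [Finset.sum_insert (by simp [hkj, hkM]), Finset.sum_insert (by simp [hjM]),
          Finset.sum_singleton, degree_of_mem_lexsegmentProducts huT] at hsum
        omega
      rw [hone, Finset.card_singleton]
      omega
    · rw [Finset.card_eq_zero.2, Nat.sub_zero]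
      rw [Finset.filter_eq_empty_iff]
      exact fun r _ hr => h ⟨r, hr⟩
  · exact Finset.monotone_filter_right _ fun r _ hr => hr.1

end LinearQuotients

theorem X_pow_dvd_monomial_iff {K : Type u} [Field K] {w : Fin n →₀ ℕ} {j : Fin n} {t : ℕ} :
    (X j : MvPolynomial (Fin n) K) ^ t ∣ monomial w (1 : K) ↔ t ≤ w j := by
  rw [X_pow_eq_monomial, monomial_dvd_monomial, Finsupp.single_le_iff]
  simp

theorem exists_lt_maxVar_of_isSqfreeQuadric {w : Fin n →₀ ℕ} (h : IsSqfreeQuadric w) :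
    ∃ j : Fin n, (j : ℕ) + 1 < maxVar w ∧ 1 ≤ w j := by
  obtain ⟨p, q, hpq, rfl⟩ := h.exists_eq_single_add_single
  rcases lt_or_gt_of_ne hpq with h | h
  · exact ⟨p, lt_maxVar_iff.2 ⟨q, h, by simp⟩, by simp⟩
  · exact ⟨q, lt_maxVar_iff.2 ⟨p, h, by simp⟩, by simp⟩

end LexsegmentCombinatorics

/-! ### Linear resolutions by iterated syzygies. -/

section LinearResolutions

variable {σ R : Type*} [CommRing R]

/-- `HasLinearResolution q N d b`: the submodule `N` of a free module has a linear free resolution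
of length at most `q`, generated in degree `d`, whose `p`-th term has rank `b p`. -/
def HasLinearResolution : ℕ → ∀ {κ : Type}, Submodule (MvPolynomial σ R) (κ → MvPolynomial σ R) →
    ℕ → (ℕ → ℕ) → Prop
  | 0, _, N, _, b => N = ⊥ ∧ b = 0
  | q + 1, κ, N, d, b => ∃ (ι : Type) (_ : Fintype ι) (g : ι → κ → MvPolynomial σ R),
      Fintype.card ι = b 0 ∧ (∀ i k, (g i k).IsHomogeneous d) ∧
      Submodule.span (MvPolynomial σ R) (Set.range g) = N ∧
      HasLinearResolution q (LinearMap.ker (Fintype.linearCombination (MvPolynomial σ R) g)) 1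
        (fun p => b (p + 1))

/-- Padding by a zero term; it brings two resolutions to a common length. -/
theorem HasLinearResolution.succ {q : ℕ} : ∀ {κ : Type}
    {N : Submodule (MvPolynomial σ R) (κ → MvPolynomial σ R)} {d : ℕ} {b : ℕ → ℕ},
    HasLinearResolution q N d b → HasLinearResolution (q + 1) N d b := by
  induction q with
  | zero =>
    rintro κ N d b ⟨rfl, rfl⟩
    refine ⟨Empty, inferInstance, Empty.elim, rfl, fun i => i.elim, ?_, ?_, rfl⟩
    · simp [Set.range_eq_empty]
    · exact Subsingleton.elim _ _
  | succ q ih =>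
    rintro κ N d b ⟨ι, _, g, h1, h2, h3, h4⟩
    exact ⟨ι, _, g, h1, h2, h3, ih h4⟩

theorem HasLinearResolution.mono {q q' : ℕ} (h : q ≤ q') {κ : Type}
    {N : Submodule (MvPolynomial σ R) (κ → MvPolynomial σ R)} {d : ℕ} {b : ℕ → ℕ}
    (hN : HasLinearResolution q N d b) : HasLinearResolution q' N d b := by
  induction h with
  | refl => exact hN
  | step _ ih => exact ih.succ

theorem homogeneousComponent_mul_of_isHomogeneous {d : ℕ} {g : MvPolynomial σ R}
    (hg : g.IsHomogeneous d) (c : MvPolynomial σ R) (k : ℕ) :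
    homogeneousComponent (k + d) (c * g) = homogeneousComponent k c * g := by
  have hsum := sum_homogeneousComponent c
  have key : ∀ j, homogeneousComponent (k + d) (homogeneousComponent j c * g) =
      if j = k then homogeneousComponent j c * g else 0 := fun j => by
    rw [homogeneousComponent_of_mem ((homogeneousComponent_isHomogeneous j c).mul hg)]
    simp [eq_comm]
  conv_lhs => rw [← hsum, Finset.sum_mul, map_sum]
  simp_rw [key]
  rw [Finset.sum_ite_eq']
  split_ifs with h
  · rfl
  · rw [homogeneousComponent_eq_zero, zero_mul]
    simpa using h

/-- Syzygies of vectors with entries in one degree form a graded module. This supplies the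
homogeneity hypothesis of the horseshoe lemma at every stage. -/
theorem homogeneousComponent_mem_ker_linearCombination {ι κ : Type} [Fintype ι] {d : ℕ}
    {g : ι → κ → MvPolynomial σ R} (hg : ∀ i k, (g i k).IsHomogeneous d)
    {c : ι → MvPolynomial σ R}
    (hc : c ∈ LinearMap.ker (Fintype.linearCombination (MvPolynomial σ R) g)) (k : ℕ) :
    (fun i => homogeneousComponent k (c i)) ∈
      LinearMap.ker (Fintype.linearCombination (MvPolynomial σ R) g) := by
  rw [LinearMap.mem_ker, Fintype.linearCombination_apply] at hc ⊢
  funext l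
  have h := congrArg (homogeneousComponent (k + d)) (congrFun hc l)
  simp only [Finset.sum_apply, Pi.smul_apply, smul_eq_mul, map_sum, Pi.zero_apply, map_zero] at h ⊢
  rw [← h]
  exact Finset.sum_congr rfl fun i _ =>
    (homogeneousComponent_mul_of_isHomogeneous (hg i l) (c i) k).symm

theorem mem_span_range_iff_exists_linearCombination {ι κ : Type} [Fintype ι]
    (g : ι → κ → MvPolynomial σ R) (x : κ → MvPolynomial σ R) :
    x ∈ Submodule.span (MvPolynomial σ R) (Set.range g) ↔
      ∃ c, Fintype.linearCombination (MvPolynomial σ R) g c = x := by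
  rw [← Fintype.range_linearCombination, LinearMap.mem_range]

theorem linearCombination_sum {ι₁ ι₂ M : Type*} [Fintype ι₁] [Fintype ι₂]
    [AddCommMonoid M] [Module (MvPolynomial σ R) M] (g₁ : ι₁ → M) (g₂ : ι₂ → M)
    (c₁ : ι₁ → MvPolynomial σ R) (c₂ : ι₂ → MvPolynomial σ R) :
    Fintype.linearCombination (MvPolynomial σ R) (Sum.elim g₁ g₂) (Sum.elim c₁ c₂) =
      Fintype.linearCombination (MvPolynomial σ R) g₁ c₁ +
        Fintype.linearCombination (MvPolynomial σ R) g₂ c₂ := by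
  simp [Fintype.linearCombination_apply]

theorem linearCombination_elim {ι κ₁ κ₂ : Type*} [Fintype ι]
    (g₁ : ι → κ₁ → MvPolynomial σ R) (g₂ : ι → κ₂ → MvPolynomial σ R)
    (c : ι → MvPolynomial σ R) :
    Fintype.linearCombination (MvPolynomial σ R) (fun i => Sum.elim (g₁ i) (g₂ i)) c =
      Sum.elim (Fintype.linearCombination (MvPolynomial σ R) g₁ c)
        (Fintype.linearCombination (MvPolynomial σ R) g₂ c) := by
  funext k
  cases k <;> simp [Fintype.linearCombination_apply, Finset.sum_apply]

theorem elim_add_elim {κ₁ κ₂ : Type*} (x₁ y₁ : κ₁ → MvPolynomial σ R)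
    (x₂ y₂ : κ₂ → MvPolynomial σ R) :
    Sum.elim x₁ x₂ + Sum.elim y₁ y₂ = Sum.elim (x₁ + y₁) (x₂ + y₂) := by
  funext k
  cases k <;> rfl

theorem elim_eq_zero_iff {κ₁ κ₂ : Type*} (x₁ : κ₁ → MvPolynomial σ R)
    (x₂ : κ₂ → MvPolynomial σ R) : Sum.elim x₁ x₂ = 0 ↔ x₁ = 0 ∧ x₂ = 0 := by
  simp [funext_iff]

/-- Horseshoe lemma for linear resolutions: `N` is a homogeneous extension of `N₂` by `N₁`. -/
theorem HasLinearResolution.extension {q : ℕ} : ∀ {κ₁ κ₂ : Type}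
    {N₁ : Submodule (MvPolynomial σ R) (κ₁ → MvPolynomial σ R)}
    {N₂ : Submodule (MvPolynomial σ R) (κ₂ → MvPolynomial σ R)}
    {N : Submodule (MvPolynomial σ R) (κ₁ ⊕ κ₂ → MvPolynomial σ R)} {d : ℕ} {b₁ b₂ : ℕ → ℕ},
    HasLinearResolution q N₁ d b₁ → HasLinearResolution q N₂ d b₂ →
    (∀ x, Sum.elim x (0 : κ₂ → MvPolynomial σ R) ∈ N ↔ x ∈ N₁) → (∀ y, y ∈ N₂ ↔ ∃ x, Sum.elim x y ∈ N) →
    (∀ z ∈ N, ∀ k, (fun i => homogeneousComponent k (z i)) ∈ N) →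
    HasLinearResolution q N d (fun p => b₁ p + b₂ p) := by
  induction q with
  | zero =>
    rintro κ₁ κ₂ N₁ N₂ N d b₁ b₂ ⟨rfl, rfl⟩ ⟨rfl, rfl⟩ h1 h2 -
    refine ⟨?_, rfl⟩
    rw [eq_bot_iff]
    intro z hz
    obtain ⟨x, y, rfl⟩ : ∃ x y, z = Sum.elim x y := ⟨_, _, (Sum.elim_comp_inl_inr z).symm⟩
    have hy : y = 0 := (h2 y).2 ⟨x, hz⟩
    subst hy
    have hx : x = 0 := (h1 x).1 hz
    subst hx
    exact (elim_eq_zero_iff _ _).2 ⟨rfl, rfl⟩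
  | succ q ih =>
    rintro κ₁ κ₂ N₁ N₂ N d b₁ b₂ ⟨ι₁, _, g₁, hc₁, hg₁, rfl, hN₁⟩ ⟨ι₂, _, g₂, hc₂, hg₂, rfl, hN₂⟩
      h1 h2 h3
    have hlift : ∀ i, ∃ x : κ₁ → MvPolynomial σ R, (∀ k, (x k).IsHomogeneous d) ∧
        Sum.elim x (g₂ i) ∈ N := fun i => by
      obtain ⟨x, hx⟩ := (h2 (g₂ i)).1 (Submodule.subset_span ⟨i, rfl⟩)
      -- Passing to degree `d` makes the lift homogeneous without changing `g₂ i`.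
      refine ⟨fun k => homogeneousComponent d (x k),
        fun k => homogeneousComponent_isHomogeneous _ _, ?_⟩
      convert h3 _ hx d using 1
      funext k
      cases k with
      | inl k => rfl
      | inr k => exact (homogeneousComponent_eq_self (hg₂ i k)).symm
    choose h hh hN using hlift
    let G₁ : ι₁ → κ₁ ⊕ κ₂ → MvPolynomial σ R := fun i => Sum.elim (g₁ i) (0 : κ₂ → _)
    let G₂ : ι₂ → κ₁ ⊕ κ₂ → MvPolynomial σ R := fun i => Sum.elim (h i) (g₂ i)
    have hlin : ∀ c₁ c₂, Fintype.linearCombination (MvPolynomial σ R) (Sum.elim G₁ G₂)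
        (Sum.elim c₁ c₂) = Sum.elim (Fintype.linearCombination (MvPolynomial σ R) g₁ c₁ +
          Fintype.linearCombination (MvPolynomial σ R) h c₂)
          (Fintype.linearCombination (MvPolynomial σ R) g₂ c₂) := fun c₁ c₂ => by
      rw [linearCombination_sum, linearCombination_elim h g₂, linearCombination_elim g₁ fun _ => 0,
        elim_add_elim]
      congr 1
      simp [Fintype.linearCombination_apply]
    have hG₂ : ∀ c₂, Sum.elim (Fintype.linearCombination (MvPolynomial σ R) h c₂)
        (Fintype.linearCombination (MvPolynomial σ R) g₂ c₂) ∈ N := fun c₂ => by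
      rw [← linearCombination_elim, Fintype.linearCombination_apply]
      exact Submodule.sum_mem _ fun i _ => Submodule.smul_mem _ _ (hN i)
    have hG : ∀ i k, (Sum.elim G₁ G₂ i k).IsHomogeneous d := by
      rintro (i | i) (k | k)
      · exact hg₁ i k
      · exact isHomogeneous_zero _ _ _
      · exact hh i k
      · exact hg₂ i k
    refine ⟨ι₁ ⊕ ι₂, inferInstance, Sum.elim G₁ G₂, ?_, hG, ?_, ?_⟩
    · rw [Fintype.card_sum, hc₁, hc₂]
    · apply le_antisymm
      · rw [Submodule.span_le]
        rintro _ ⟨i | i, rfl⟩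
        · exact (h1 _).2 (Submodule.subset_span ⟨i, rfl⟩)
        · exact hN i
      · intro z hz
        obtain ⟨x, y, rfl⟩ : ∃ x y, z = Sum.elim x y := ⟨_, _, (Sum.elim_comp_inl_inr z).symm⟩
        obtain ⟨c₂, rfl⟩ := (mem_span_range_iff_exists_linearCombination _ _).1 ((h2 y).2 ⟨x, hz⟩)
        have hx : x - Fintype.linearCombination (MvPolynomial σ R) h c₂ ∈
            Submodule.span (MvPolynomial σ R) (Set.range g₁) := by
          rw [← h1]
          convert N.sub_mem hz (hG₂ c₂) using 1
          funext k
          cases k <;> simp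
        obtain ⟨c₁, hc⟩ := (mem_span_range_iff_exists_linearCombination _ _).1 hx
        rw [mem_span_range_iff_exists_linearCombination]
        refine ⟨Sum.elim c₁ c₂, ?_⟩
        rw [hlin, hc, sub_add_cancel]
    -- The kernels again form an extension. A syzygy `c` of `g₂` lifts because the combination of
    -- the lifts `h` with coefficients `c` lands in `N₁`, where the `g₁` can cancel it.
    · refine ih hN₁ hN₂ (fun c => ?_) (fun c => ⟨fun hc => ?_, ?_⟩)
        (fun z hz k => homogeneousComponent_mem_ker_linearCombination hG hz k)
      · rw [LinearMap.mem_ker, LinearMap.mem_ker, hlin, elim_eq_zero_iff]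
        simp
      · have hx : Fintype.linearCombination (MvPolynomial σ R) h c ∈
            Submodule.span (MvPolynomial σ R) (Set.range g₁) := by
          rw [← h1, ← LinearMap.mem_ker.1 hc]
          exact hG₂ c
        obtain ⟨c₁, hc₁⟩ := (mem_span_range_iff_exists_linearCombination _ _).1 hx
        refine ⟨-c₁, ?_⟩
        rw [LinearMap.mem_ker, hlin, elim_eq_zero_iff, map_neg, hc₁, LinearMap.mem_ker.1 hc]
        simp
      · rintro ⟨c₁, hc₁⟩
        rw [LinearMap.mem_ker, hlin, elim_eq_zero_iff] at hc₁
        exact hc₁.2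

/-- An ideal, as a submodule of the free module on one generator. -/
noncomputable def idealAsSubmodule (J : Ideal (MvPolynomial σ R)) :
    Submodule (MvPolynomial σ R) (Unit → MvPolynomial σ R) :=
  Submodule.comap (LinearMap.proj ()) J

theorem mem_idealAsSubmodule {J : Ideal (MvPolynomial σ R)} {f : Unit → MvPolynomial σ R} :
    f ∈ idealAsSubmodule J ↔ f () ∈ J :=
  Iff.rfl

/-- The linear resolution of `J + (u)` obtained from those of `J` and of the ideal `L = J : u`. -/
theorem HasLinearResolution.sup_span_singleton {q q' : ℕ} {J L : Ideal (MvPolynomial σ R)} {d : ℕ}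
    {b c : ℕ → ℕ} (hJ : HasLinearResolution q (idealAsSubmodule J) d b)
    (hL : HasLinearResolution q' (idealAsSubmodule L) 1 c) {u : MvPolynomial σ R}
    (hu : u.IsHomogeneous d) (hJL : ∀ f, f * u ∈ J ↔ f ∈ L) :
    HasLinearResolution (max q q' + 1) (idealAsSubmodule (J ⊔ Ideal.span {u})) d
      (fun p => b p + (if p = 0 then 1 else c (p - 1))) := by
  obtain ⟨ι, _, g, hc, hg, hgJ, hker⟩ := (hJ.mono (le_max_left q q')).succ
  have hlin : ∀ (c₁ : ι → MvPolynomial σ R) (c₂ : Unit → MvPolynomial σ R),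
      Fintype.linearCombination (MvPolynomial σ R) (Sum.elim g (fun _ _ => u : Unit → Unit → _))
        (Sum.elim c₁ c₂) = fun _ => Fintype.linearCombination (MvPolynomial σ R) g c₁ () +
          c₂ () * u := fun c₁ c₂ => by
    rw [linearCombination_sum]
    funext k
    simp [Fintype.linearCombination_apply]
  have hmem : ∀ f, f ∈ J ↔ ∃ c, Fintype.linearCombination (MvPolynomial σ R) g c () = f := by
    intro f
    rw [show f ∈ J ↔ (fun _ => f) ∈ idealAsSubmodule J from Iff.rfl, ← hgJ,
      mem_span_range_iff_exists_linearCombination]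
    exact exists_congr fun c => ⟨fun h => congrFun h (), fun h => funext fun _ => h⟩
  have hG : ∀ i k, (Sum.elim g (fun _ _ => u : Unit → Unit → _) i k).IsHomogeneous d := by
    rintro (i | i) k
    exacts [hg i k, hu]
  refine ⟨ι ⊕ Unit, inferInstance, Sum.elim g (fun _ _ => u), by simp [hc], hG, ?_, ?_⟩
  · ext f
    rw [mem_span_range_iff_exists_linearCombination, mem_idealAsSubmodule, Submodule.mem_sup]
    constructor
    · rintro ⟨c, rfl⟩
      obtain ⟨c₁, c₂, rfl⟩ : ∃ x y, c = Sum.elim x y := ⟨_, _, (Sum.elim_comp_inl_inr c).symm⟩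
      rw [hlin]
      exact ⟨_, (hmem _).2 ⟨c₁, rfl⟩, _, Ideal.mem_span_singleton'.2 ⟨c₂ (), rfl⟩, rfl⟩
    · rintro ⟨x, hx, y, hy, hxy⟩
      obtain ⟨c₁, rfl⟩ := (hmem _).1 hx
      obtain ⟨a, rfl⟩ := Ideal.mem_span_singleton'.1 hy
      refine ⟨Sum.elim c₁ fun _ => a, ?_⟩
      rw [hlin]
      exact funext fun _ => hxy
  -- The coefficients of `u` in syzygies of `(g, u)` form exactly `L`, and the syzygies without `u`
  -- are those of `g`. Hence `c` enters shifted by one.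
  · refine (hker.extension (hL.mono (le_max_right q q')) (fun x => ?_) (fun y => ?_)
      fun z hz k => homogeneousComponent_mem_ker_linearCombination hG hz k :)
    · rw [LinearMap.mem_ker, LinearMap.mem_ker, hlin]
      simp only [Pi.zero_apply, zero_mul, add_zero]
    · rw [mem_idealAsSubmodule, ← hJL, hmem]
      constructor
      · rintro ⟨c, hc⟩
        refine ⟨-c, ?_⟩
        rw [LinearMap.mem_ker, hlin, map_neg, ← hc]
        funext k
        simp
      · rintro ⟨x, hx⟩
        rw [LinearMap.mem_ker, hlin] at hx
        refine ⟨-x, ?_⟩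
        rw [map_neg, Pi.neg_apply]
        exact neg_eq_of_add_eq_zero_right (congrFun hx ())

theorem HasLinearResolution.bot (d : ℕ) :
    HasLinearResolution 0 (idealAsSubmodule (⊥ : Ideal (MvPolynomial σ R))) d 0 := by
  refine ⟨?_, rfl⟩
  ext f
  exact ⟨fun h => funext fun _ => h, fun h => congrFun h ()⟩

/-- The linear (Koszul) resolution of an ideal generated by variables. -/
theorem exists_hasLinearResolution_span_X (A : Finset σ) :
    ∃ q, HasLinearResolution q
      (idealAsSubmodule (Ideal.span (X '' (A : Set σ)) : Ideal (MvPolynomial σ R))) 1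
      (fun p => A.card.choose (p + 1)) := by
  classical
  induction A using Finset.induction_on with
  | empty =>
    refine ⟨0, ?_⟩
    convert HasLinearResolution.bot (σ := σ) (R := R) 1 using 1
    · simp
    · funext p; simp
  | insert r A hr ih =>
    obtain ⟨q, hq⟩ := ih
    have := hq.sup_span_singleton hq (isHomogeneous_X R r) (fun f => ?_)
    · refine ⟨max q q + 1, ?_⟩
      convert this using 1
      · rw [Finset.coe_insert, Set.image_insert_eq, Ideal.span_insert, sup_comm]
      · funext p
        rw [Finset.card_insert_of_notMem hr]
        cases p with
        | zero => simp
        | succ p =>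
          rw [Nat.choose_succ_succ' A.card (p + 1), add_comm]
          simp
    -- A new variable is a nonzerodivisor modulo the old ones, so the colon ideal is the old ideal
    -- itself; the ranks then add by Pascal's rule.
    · rw [mem_ideal_span_X_image, mem_ideal_span_X_image, support_mul_X]
      simp only [Finset.mem_map, addRightEmbedding_apply, forall_exists_index, and_imp,
        forall_apply_eq_imp_iff₂, Finsupp.add_apply]
      refine forall₂_congr fun m _ => exists_congr fun i => and_congr_right fun hi => ?_
      rw [Finsupp.single_eq_of_ne (by rintro rfl; exact hr hi), add_zero]

/-- An ideal with linear quotients with respect to generators of the same degree has a linear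
resolution. -/
theorem exists_hasLinearResolution_of_linearQuotients {d m : ℕ} (f : Fin m → MvPolynomial σ R)
    (hf : ∀ i, (f i).IsHomogeneous d) (A : Fin m → Finset σ)
    (hA : ∀ i, (Ideal.span (f '' Set.Iio i)).colon {f i} = Ideal.span (X '' (A i : Set σ))) :
    ∃ q, HasLinearResolution q (idealAsSubmodule (Ideal.span (Set.range f))) d
      (fun p => ∑ i, (A i).card.choose p) := by
  induction m with
  | zero =>
    refine ⟨0, ?_⟩
    convert HasLinearResolution.bot (σ := σ) (R := R) d using 1
    · simp [Set.range_eq_empty]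
    · funext p; simp
  | succ m ih =>
    obtain ⟨q, hq⟩ := ih (fun i => f i.castSucc) (fun i => hf _) (fun i => A i.castSucc)
      (fun i => by
        rw [← hA i.castSucc]
        congr 2
        ext x
        constructor
        · rintro ⟨j, hj, rfl⟩
          exact ⟨j.castSucc, Fin.castSucc_lt_castSucc_iff.2 hj, rfl⟩
        · rintro ⟨j, hj, rfl⟩
          have hj' : j < i.castSucc := hj
          have hjm : (j : ℕ) < m := lt_trans hj' i.2
          exact ⟨⟨j, hjm⟩, hj', rfl⟩)
    obtain ⟨q', hq'⟩ := exists_hasLinearResolution_span_X (R := R) (A (Fin.last m))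
    have hcone := hq.sup_span_singleton hq' (hf (Fin.last m)) (fun g => ?_)
    · refine ⟨max q q' + 1, ?_⟩
      convert hcone using 1
      · rw [← Ideal.span_union]
        congr 2
        ext x
        constructor
        · rintro ⟨i, rfl⟩
          induction i using Fin.lastCases with
          | last => exact Or.inr rfl
          | cast i => exact Or.inl ⟨i, rfl⟩
        · rintro (⟨i, rfl⟩ | rfl)
          exacts [⟨_, rfl⟩, ⟨_, rfl⟩]
      · funext p
        rw [Fin.sum_univ_castSucc]
        cases p <;> simp
    · rw [← hA, Submodule.mem_colon_singleton, smul_eq_mul]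
      congr! 3
      ext x
      constructor
      · rintro ⟨i, rfl⟩
        exact ⟨i.castSucc, Fin.castSucc_lt_last i, rfl⟩
      · rintro ⟨j, hj, rfl⟩
        have hj' : j < Fin.last m := hj
        exact ⟨⟨j, hj'⟩, rfl⟩

end LinearResolutions

/-! ### Splicing projective resolutions. -/

section Resolutions

open Limits

variable {C : Type*} [Category* C] [Abelian C]

/-- The augmentation `P₀ ⟶ Z` of a projective resolution of `Z`. -/
noncomputable def resolutionAugmentation {Z : C} (P : ProjectiveResolution Z) :
    P.complex.X 0 ⟶ Z :=
  P.π.f 0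

theorem d_comp_resolutionAugmentation {Z : C} (P : ProjectiveResolution Z) :
    P.complex.d 1 0 ≫ resolutionAugmentation P = 0 :=
  P.complex_d_comp_π_f_zero

theorem exact_resolutionAugmentation {Z : C} (P : ProjectiveResolution Z) :
    (ShortComplex.mk _ _ (d_comp_resolutionAugmentation P)).Exact :=
  P.exact₀

instance {Z : C} (P : ProjectiveResolution Z) : Epi (resolutionAugmentation P) :=
  inferInstanceAs (Epi (P.π.f 0))

/-- Splicing a projective resolution of `S.X₁` with a short exact sequence
`0 ⟶ S.X₁ ⟶ S.X₂ ⟶ S.X₃ ⟶ 0` whose middle term is projective. -/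
noncomputable def spliceComplex (S : ShortComplex C) (P : ProjectiveResolution S.X₁) :
    ChainComplex C ℕ :=
  ChainComplex.augment P.complex (resolutionAugmentation P ≫ S.f) (by
    rw [← Category.assoc, d_comp_resolutionAugmentation, zero_comp])

/-- Only the spot next to the splice is new: composing the augmentation with the monomorphism `S.f`
does not change its kernel. -/
theorem spliceComplex_exactAt_succ (S : ShortComplex C) (hS : S.ShortExact)
    (P : ProjectiveResolution S.X₁) (k : ℕ) : (spliceComplex S P).ExactAt (k + 1) := by
  rw [HomologicalComplex.exactAt_iff' _ (k + 2) (k + 1) k (by simp) (by simp)]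
  cases k with
  | zero =>
    have := hS.mono_f
    let T : ShortComplex C := ShortComplex.mk (P.complex.d 1 0)
      (resolutionAugmentation P ≫ S.f) (by
        rw [← Category.assoc, d_comp_resolutionAugmentation, zero_comp])
    let φ : ShortComplex.mk _ _ (d_comp_resolutionAugmentation P) ⟶ T :=
      { τ₁ := 𝟙 _, τ₂ := 𝟙 _, τ₃ := S.f
        comm₁₂ := by simp [T]
        comm₂₃ := by simp [T] }
    have h1 : Epi φ.τ₁ := inferInstanceAs (Epi (𝟙 _))
    have h2 : IsIso φ.τ₂ := inferInstanceAs (IsIso (𝟙 _))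
    have h3 : Mono φ.τ₃ := this
    exact (ShortComplex.exact_iff_of_epi_of_isIso_of_mono φ).1 (exact_resolutionAugmentation P)
  | succ k => exact P.exact_succ k

theorem spliceComplex_d_comp (S : ShortComplex C) (P : ProjectiveResolution S.X₁) :
    (spliceComplex S P).d 1 0 ≫ S.g = 0 := by
  change (resolutionAugmentation P ≫ S.f) ≫ S.g = 0
  rw [Category.assoc, S.zero, comp_zero]

/-- Precomposing `S.f` with an epimorphism does not change its image. -/
theorem spliceComplex_exact_zero (S : ShortComplex C) (hS : S.ShortExact)
    (P : ProjectiveResolution S.X₁) :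
    (ShortComplex.mk _ _ (spliceComplex_d_comp S P)).Exact := by
  let T : ShortComplex C := ShortComplex.mk (resolutionAugmentation P ≫ S.f) S.g (by
    rw [Category.assoc, S.zero, comp_zero])
  let φ : T ⟶ S :=
    { τ₁ := resolutionAugmentation P, τ₂ := 𝟙 _, τ₃ := 𝟙 _
      comm₁₂ := by simp [T]
      comm₂₃ := by simp [T] }
  have h1 : Epi φ.τ₁ := inferInstanceAs (Epi (resolutionAugmentation P))
  have h2 : IsIso φ.τ₂ := inferInstanceAs (IsIso (𝟙 _))
  have h3 : Mono φ.τ₃ := inferInstanceAs (Mono (𝟙 _))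
  exact (ShortComplex.exact_iff_of_epi_of_isIso_of_mono φ).2 hS.exact

theorem exists_projectiveResolution_splice (S : ShortComplex C) (hS : S.ShortExact)
    [Projective S.X₂] (P : ProjectiveResolution S.X₁) :
    ∃ Q : ProjectiveResolution S.X₃, Q.complex = spliceComplex S P := by
  refine ⟨{ complex := spliceComplex S P
            projective := fun k => ?_
            π := (ChainComplex.toSingle₀Equiv _ _).symm ⟨S.g, spliceComplex_d_comp S P⟩
            quasiIso := ⟨fun k => ?_⟩ }, rfl⟩
  · cases k with
    | zero => exact inferInstanceAs (Projective S.X₂)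
    | succ k => exact P.projective k
  · cases k with
    | zero =>
      rw [ChainComplex.quasiIsoAt₀_iff, ShortComplex.quasiIso_iff_of_zeros']
      · have := hS.epi_g
        refine (ShortComplex.exact_and_epi_g_iff_of_iso ?_).2
          ⟨spliceComplex_exact_zero S hS P, this⟩
        have hg := ChainComplex.toSingle₀Equiv_symm_apply_f_zero (C := spliceComplex S P)
          (X := S.X₃) S.g (spliceComplex_d_comp S P)
        refine ShortComplex.isoMk (Iso.refl _) (Iso.refl _) (Iso.refl _)
          ((Category.id_comp _).trans (Category.comp_id _).symm) ?_
        refine (Category.id_comp S.g).trans (hg.symm.trans ?_)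
        exact (Category.comp_id _).symm
      all_goals rfl
    | succ k =>
      rw [quasiIsoAt_iff_exactAt']
      · exact spliceComplex_exactAt_succ S hS P k
      · exact ChainComplex.exactAt_succ_single_obj _ _

/-- A chain complex with zero differentials is isomorphic to its homology. -/
theorem nonempty_homology_iso_of_d_eq_zero (K : ChainComplex C ℕ)
    (h : ∀ i j, K.d i j = 0) (p : ℕ) : Nonempty (K.homology p ≅ K.X p) := by
  have h1 := K.isIso_iCycles p _ rfl (h p _)
  have h2 := K.isIso_homologyπ _ p rfl (h _ p)
  exact ⟨(asIso (K.homologyπ p)).symm ≪≫ asIso (K.iCycles p)⟩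

theorem nonempty_leftDerived_iso {D : Type*} [Category* D] [Abelian D] {X : C}
    (P : ProjectiveResolution X) (F : C ⥤ D) [F.Additive] [HasProjectiveResolutions C]
    (h : ∀ i j, F.map (P.complex.d i j) = 0) (p : ℕ) :
    Nonempty ((F.leftDerived p).obj X ≅ F.obj (P.complex.X p)) := by
  obtain ⟨e⟩ := nonempty_homology_iso_of_d_eq_zero
    ((F.mapHomologicalComplex _).obj P.complex) h p
  exact ⟨P.isoLeftDerivedObj F p ≪≫ e⟩

end Resolutions

/-! ### Tor from a linear resolution. -/

section BettiNumbers

open MonoidalCategory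

variable {n : ℕ} {K : Type u} [Field K]

theorem IsHomogeneous.mem_idealOfVars {f : MvPolynomial (Fin n) K} (hf : f.IsHomogeneous 1) :
    f ∈ idealOfVars (Fin n) K := by
  rw [← pow_one (idealOfVars (Fin n) K), mem_pow_idealOfVars_iff']
  intro x hx
  exact hf.coeff_eq_zero (by omega)

theorem HasLinearResolution.apply_mem_idealOfVars {q : ℕ} {κ : Type}
    {N : Submodule (MvPolynomial (Fin n) K) (κ → MvPolynomial (Fin n) K)} {b : ℕ → ℕ}
    (h : HasLinearResolution q N 1 b) {y : κ → MvPolynomial (Fin n) K} (hy : y ∈ N) (k : κ) :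
    y k ∈ idealOfVars (Fin n) K := by
  -- Padding exposes a generating family even when `q = 0`.
  obtain ⟨ι, _, g, -, hg, rfl, -⟩ := h.succ
  obtain ⟨c, rfl⟩ := (mem_span_range_iff_exists_linearCombination _ _).1 hy
  rw [Fintype.linearCombination_apply, Finset.sum_apply]
  exact Ideal.sum_mem _ fun i _ => Ideal.mul_mem_left _ _ (IsHomogeneous.mem_idealOfVars (hg i k))

variable (n K) in
/-- The residue field `S/(x₁, …, xₙ)` as an `S`-module. -/
noncomputable abbrev residueModule : ModuleCat.{u} (MvPolynomial (Fin n) K) :=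
  ModuleCat.of _ (MvPolynomial (Fin n) K ⧸
    Ideal.span (Set.range (X : Fin n → MvPolynomial (Fin n) K)))

/-- Coordinates in the maximal ideal move across the tensor product and annihilate the residue
field; this is minimality of the resolution. -/
theorem residueModule_whiskerLeft_eq_zero {ι : Type} [Fintype ι]
    {M : ModuleCat.{u} (MvPolynomial (Fin n) K)}
    (f : M ⟶ ModuleCat.of (MvPolynomial (Fin n) K) (ι → MvPolynomial (Fin n) K))
    (hf : ∀ (y : M) (k : ι), f.hom y k ∈ idealOfVars (Fin n) K) :
    residueModule n K ◁ f = 0 := by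
  classical
  refine ModuleCat.MonoidalCategory.tensor_ext fun x y => ?_
  change TensorProduct.tmul (MvPolynomial (Fin n) K) x (f.hom y) = 0
  have hsum : f.hom y = ∑ k, f.hom y k • (Pi.single k 1 : ι → MvPolynomial (Fin n) K) :=
    pi_eq_sum_univ' (f.hom y)
  rw [hsum, TensorProduct.tmul_sum]
  refine Finset.sum_eq_zero fun k _ => ?_
  rw [TensorProduct.tmul_smul, TensorProduct.smul_tmul']
  have hx : f.hom y k • x = 0 := by
    obtain ⟨s, rfl⟩ := Ideal.Quotient.mk_surjective x
    exact Ideal.Quotient.eq_zero_iff_mem.2 (Ideal.mul_mem_right _ _ (hf y k))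
  rw [hx, TensorProduct.zero_tmul]

/-- Splicing along the syzygies gives a minimal free resolution. Every syzygy module is generated in
degree `1`, so its inclusion dies over the residue field; the degree `d` of the first generators
plays no role. -/
theorem HasLinearResolution.exists_projectiveResolution {q : ℕ} : ∀ {κ : Type}
    {N : Submodule (MvPolynomial (Fin n) K) (κ → MvPolynomial (Fin n) K)} {d : ℕ} {b : ℕ → ℕ},
    HasLinearResolution q N d b →
    ∃ P : ProjectiveResolution (ModuleCat.of (MvPolynomial (Fin n) K) N),
      (∀ i j, residueModule n K ◁ P.complex.d i j = 0) ∧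
      ∀ p, ∃ (ι : Type) (_ : Fintype ι), Fintype.card ι = b p ∧
        Nonempty (P.complex.X p ≅
          ModuleCat.of (MvPolynomial (Fin n) K) (ι → MvPolynomial (Fin n) K)) := by
  induction q with
  | zero =>
    rintro κ N d b ⟨rfl, rfl⟩
    have hz : Limits.IsZero (ModuleCat.of (MvPolynomial (Fin n) K)
        (⊥ : Submodule (MvPolynomial (Fin n) K) (κ → MvPolynomial (Fin n) K))) :=
      ModuleCat.isZero_of_subsingleton _
    have := hz.projective
    have hX : ∀ p, Limits.IsZero ((ProjectiveResolution.self (ModuleCat.of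
        (MvPolynomial (Fin n) K)
        (⊥ : Submodule (MvPolynomial (Fin n) K) (κ → MvPolynomial (Fin n) K)))).complex.X p) := by
      intro p
      by_cases hp : p = 0
      · subst hp
        exact hz
      · exact HomologicalComplex.isZero_single_obj_X _ _ _ _ hp
    refine ⟨ProjectiveResolution.self _, fun i j => ?_, fun p => ⟨Empty, inferInstance, rfl, ?_⟩⟩
    · rw [(hX i).eq_of_src (HomologicalComplex.d _ i j) 0, MonoidalPreadditive.whiskerLeft_zero]
    · exact ⟨(hX p).iso (ModuleCat.isZero_of_subsingleton _)⟩
  | succ q ih =>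
    rintro κ N d b ⟨ι, _, g, hc, hg, hN, hker⟩
    obtain ⟨P, hP, hPX⟩ := ih hker
    rw [← Fintype.range_linearCombination] at hN
    subst hN
    let f := Fintype.linearCombination (MvPolynomial (Fin n) K) g
    let S : ShortComplex (ModuleCat.{u} (MvPolynomial (Fin n) K)) :=
      { X₁ := ModuleCat.of _ (LinearMap.ker f)
        X₂ := ModuleCat.of _ (ι → MvPolynomial (Fin n) K)
        X₃ := ModuleCat.of _ (LinearMap.range f)
        f := ModuleCat.ofHom (LinearMap.ker f).subtype
        g := ModuleCat.ofHom f.rangeRestrict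
        zero := by
          ext x : 2
          exact Subtype.ext (LinearMap.mem_ker.1 x.2) }
    have hS : S.ShortExact :=
      { exact := (ShortComplex.ShortExact.moduleCat_exact_iff_function_exact _).2 fun x => by
          change f.rangeRestrict x = 0 ↔ x ∈ Set.range (LinearMap.ker f).subtype
          rw [Submodule.coe_subtype, Subtype.range_coe, SetLike.mem_coe, LinearMap.mem_ker,
            ← LinearMap.mem_ker, LinearMap.ker_rangeRestrict, LinearMap.mem_ker]
        mono_f := (ModuleCat.mono_iff_injective _).2 (LinearMap.ker f).injective_subtype
        epi_g := (ModuleCat.epi_iff_surjective _).2 f.surjective_rangeRestrict }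
    have hproj : Projective S.X₂ :=
      (IsProjective.iff_projective (R := MvPolynomial (Fin n) K) _).1
        (inferInstanceAs (Module.Projective _ (ι → MvPolynomial (Fin n) K)))
    have hSf : residueModule n K ◁ S.f = 0 :=
      residueModule_whiskerLeft_eq_zero _ fun y k => hker.apply_mem_idealOfVars y.2 k
    obtain ⟨Q, hQ⟩ := exists_projectiveResolution_splice S hS P
    refine ⟨Q, ?_, ?_⟩
    · rw [hQ]
      intro i j
      match i, j with
      | 1, 0 =>
        -- The only differential not already in `P` factors through the inclusion of the syzygies.
        change residueModule n K ◁ (resolutionAugmentation P ≫ S.f) = 0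
        rw [MonoidalCategory.whiskerLeft_comp, hSf, Limits.comp_zero]
      | 1, j + 1 => exact hP 0 j
      | i + 2, j + 1 => exact hP (i + 1) j
      | 0, j =>
        rw [HomologicalComplex.shape _ _ _ (by simp), MonoidalPreadditive.whiskerLeft_zero]
      | i + 2, 0 =>
        rw [HomologicalComplex.shape _ _ _ (by simp), MonoidalPreadditive.whiskerLeft_zero]
    · rw [hQ]
      intro p
      cases p with
      | zero => exact ⟨ι, _, hc, ⟨Iso.refl _⟩⟩
      | succ p => exact hPX p

/-- `S/(x₁, …, xₙ)` is a copy of `K`. -/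
theorem bijective_residueModule_pi (ι : Type) :
    Function.Bijective (fun (v : ι → K) (i : ι) =>
      Ideal.Quotient.mk (Ideal.span (Set.range (X : Fin n → MvPolynomial (Fin n) K)))
        (C (v i))) := by
  constructor
  · intro v w h
    funext i
    have hi := Ideal.Quotient.eq.1 (congrFun h i)
    rw [← C_sub] at hi
    have := (C_mem_pow_idealOfVars_iff (σ := Fin n) 1 (v i - w i)).1 (by rwa [pow_one])
    simpa [sub_eq_zero] using this
  · intro y
    choose s hs using fun i => Ideal.Quotient.mk_surjective (y i)
    refine ⟨fun i => constantCoeff (s i), funext fun i => ?_⟩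
    rw [← hs i, Ideal.Quotient.eq]
    change _ ∈ idealOfVars (Fin n) K
    rw [← pow_one (idealOfVars (Fin n) K), mem_pow_idealOfVars_iff']
    intro x hx
    obtain rfl : x = 0 := (Finsupp.degree_eq_zero_iff x).1 (by omega)
    simp [constantCoeff_eq]

theorem rank_restrictScalars_residueModule_pi (ι : Type) [Fintype ι] :
    Module.rank K ((ModuleCat.restrictScalars (algebraMap K (MvPolynomial (Fin n) K))).obj
      (ModuleCat.of (MvPolynomial (Fin n) K) (ι → residueModule n K))) = Fintype.card ι := by
  let e : (ι → K) →ₗ[K] ((ModuleCat.restrictScalars (algebraMap K (MvPolynomial (Fin n) K))).obj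
      (ModuleCat.of (MvPolynomial (Fin n) K) (ι → residueModule n K))) :=
    { toFun := fun v i => Ideal.Quotient.mk _ (C (v i))
      map_add' := fun v w => funext fun i => by
        change Ideal.Quotient.mk _ (C (v i + w i)) = _
        rw [C_add, map_add]
        rfl
      map_smul' := fun a v => funext fun i => by
        change Ideal.Quotient.mk _ (C (a * v i)) = _
        rw [C_mul, map_mul]
        rfl }
  rw [← (LinearEquiv.ofBijective e (bijective_residueModule_pi ι)).rank_eq, rank_fun']

theorem rank_restrictScalars_congr {M N : ModuleCat.{u} (MvPolynomial (Fin n) K)} (e : M ≅ N) :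
    Module.rank K ((ModuleCat.restrictScalars (algebraMap K (MvPolynomial (Fin n) K))).obj M) =
      Module.rank K
        ((ModuleCat.restrictScalars (algebraMap K (MvPolynomial (Fin n) K))).obj N) :=
  ((ModuleCat.restrictScalars (algebraMap K (MvPolynomial (Fin n) K))).mapIso
    e).toLinearEquiv.rank_eq

/-- The Betti numbers of an ideal are the ranks in its linear resolution. -/
theorem HasLinearResolution.betti_eq {q d : ℕ} {J : Ideal (MvPolynomial (Fin n) K)} {b : ℕ → ℕ}
    (h : HasLinearResolution q (idealAsSubmodule J) d b) (p : ℕ) :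
    betti p J = (b p : Cardinal) := by
  classical
  obtain ⟨P, hP, hX⟩ := h.exists_projectiveResolution
  obtain ⟨ι, _, hι, ⟨eX⟩⟩ := hX p
  obtain ⟨e⟩ := nonempty_leftDerived_iso P
    ((tensoringLeft (ModuleCat.{u} (MvPolynomial (Fin n) K))).obj (residueModule n K)) hP p
  let eJ : ModuleCat.of (MvPolynomial (Fin n) K) J ≅
      ModuleCat.of (MvPolynomial (Fin n) K) (idealAsSubmodule J) :=
    LinearEquiv.toModuleIso
      { toFun := fun f => ⟨fun _ => f.1, f.2⟩
        map_add' := fun _ _ => rfl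
        map_smul' := fun _ _ => rfl
        invFun := fun f => ⟨f.1 (), f.2⟩
        left_inv := fun _ => rfl
        right_inv := fun _ => rfl }
  let eT : residueModule n K ⊗ ModuleCat.of (MvPolynomial (Fin n) K)
      (ι → MvPolynomial (Fin n) K) ≅
      ModuleCat.of (MvPolynomial (Fin n) K) (ι → residueModule n K) :=
    LinearEquiv.toModuleIso (TensorProduct.piScalarRight (MvPolynomial (Fin n) K)
      (MvPolynomial (Fin n) K) (residueModule n K) ι)
  rw [← hι, ← rank_restrictScalars_residueModule_pi (n := n) (K := K) ι]
  exact rank_restrictScalars_congr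
    (((Tor (ModuleCat.{u} (MvPolynomial (Fin n) K)) p).obj (residueModule n K)).mapIso eJ ≪≫ e ≪≫
      whiskerLeftIso _ eX ≪≫ eT)

end BettiNumbers

/-! ### The theorem on powers of lexsegment edge ideals. -/

open Classical in
theorem mainTheorem4 {K : Type u} [Field K] {n : ℕ}
    (I : Ideal (MvPolynomial (Fin n) K)) (hI : IsInitialLexsegmentEdgeIdeal I)
    (t : ℕ) (ht : 1 ≤ t)
    {m : ℕ} (u : Fin m → (Fin n →₀ ℕ))
    (hlex : StrictAnti fun i => toLex (u i))
    (hG : Set.range u = minMonomialGens (I ^ t)) :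
    -- the order `u₁ >_lex ⋯ >_lex u_m` gives linear quotients
    (∀ i, quotientIdeal K u i = Ideal.span (X '' linearSet K u i)) ∧
    -- the cardinality of `set(u_i)`
    (∀ i, (linearSet K u i).ncard =
      if ∃ j : Fin n, (j : ℕ) + 1 < maxVar (u i) ∧
          (X j : MvPolynomial (Fin n) K) ^ t ∣ monomial (u i) (1 : K)
      then maxVar (u i) - 2 else maxVar (u i) - 1) ∧
    -- the Betti numbers of `I`
    (t = 1 → ∀ p : ℕ, betti p I = ((∑ i, (maxVar (u i) - 2).choose p : ℕ) : Cardinal)) ∧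
    -- the Betti numbers of `I ^ t`
    (∀ p : ℕ, betti p (I ^ t) =
      (((∑ i with ¬ ∃ j : Fin n, (j : ℕ) + 1 < maxVar (u i) ∧
            (X j : MvPolynomial (Fin n) K) ^ t ∣ monomial (u i) (1 : K),
          (maxVar (u i) - 1).choose p) +
        ∑ i with ∃ j : Fin n, (j : ℕ) + 1 < maxVar (u i) ∧
            (X j : MvPolynomial (Fin n) K) ^ t ∣ monomial (u i) (1 : K),
          (maxVar (u i) - 2).choose p : ℕ) : Cardinal)) := by
  obtain ⟨v, hv, rfl⟩ := hI
  rw [span_initialLexsegment_pow,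
    minMonomialGens_span_of_degree_eq fun w => degree_of_mem_lexsegmentProducts] at hG
  simp only [X_pow_dvd_monomial_iff]
  have hquot := quotientIdeal_eq_span_linearSet (K := K) hlex hG
  have hcard := fun i => ncard_linearSet (K := K) hlex hG i
  have hbetti : ∀ p : ℕ,
      betti p ((Ideal.span ((fun w => monomial w (1 : K)) '' initialLexsegment v)) ^ t) =
        ((∑ i, (linearSet K u i).ncard.choose p : ℕ) : Cardinal) := by
    intro p
    obtain ⟨q, hq⟩ := exists_hasLinearResolution_of_linearQuotients (d := 2 * t)
      (fun i => monomial (u i) (1 : K))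
      (fun i => isHomogeneous_monomial _
        (degree_of_mem_lexsegmentProducts (hG ▸ Set.mem_range_self i)))
      (fun i => (linearSet K u i).toFinset)
      (fun i => by rw [Set.coe_toFinset]; exact hquot i)
    rw [span_initialLexsegment_pow, ← hG, ← Set.range_comp]
    refine (hq.betti_eq p).trans ?_
    simp only [Set.ncard_eq_toFinset_card']
  refine ⟨hquot, hcard, ?_, ?_⟩
  · rintro rfl p
    rw [← pow_one (Ideal.span _), hbetti]
    congr 1
    refine Finset.sum_congr rfl fun i _ => ?_
    obtain ⟨s, hs, hsv, hsu⟩ : u i ∈ lexsegmentProducts v 1 := hG ▸ Set.mem_range_self i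
    obtain ⟨e, rfl⟩ := Multiset.card_eq_one.1 hs
    rw [Multiset.sum_singleton] at hsu
    have hsq := (hsv e (Multiset.mem_singleton_self e)).1
    rw [hsu] at hsq
    -- For `t = 1` the smaller variable of an edge already has exponent `t`, so every generator
    -- falls in the first case.
    rw [hcard i, if_pos (exists_lt_maxVar_of_isSqfreeQuadric hsq)]
  · intro p
    rw [hbetti, ← Finset.sum_filter_not_add_sum_filter _ fun i =>
      ∃ j : Fin n, (j : ℕ) + 1 < maxVar (u i) ∧ t ≤ u i j]
    congr 2
    · exact Finset.sum_congr rfl fun i hi => by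
        rw [hcard i, if_neg (Finset.mem_filter.1 hi).2]
    · exact Finset.sum_congr rfl fun i hi => by
        rw [hcard i, if_pos (Finset.mem_filter.1 hi).2]
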